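/- All graphs are finite, undirected and simple (no loops, no multiple edges). For graphs $G,H$, the graph $G$ is \emph{$H$-mixing} if the graph whose vertices are the homomorphisms $G\to H$, two of them being adjacent when they differ at exactly one vertex of $G$, is connected (in particular there is at least one homomorphism). For integers $q\ge 1$ and $k\ge 2q$, the circular clique $G_{k,q}$ has vertex set $\{0,1,\dots,k-1\}$ and $ij$ is an edge when $q\le |i-j|\le k-q$. Say that $G$ is \emph{$k$-mixing} if it is $K_k$-mixing, and \emph{$(k,q)$-mixing} if it is $G_{k,q}$-mixing. Let $\chi(G)$ be the chromatic number, and let $\chi_c(G)=\inf\{k/q : q\ge 1,\ k\ge 2q,\ G\to G_{k,q}\}$ be the circular chromatic number, where $G\to G_{k,q}$ means that a homomorphism exists. Define the mixing threshold and the circular mixing threshold by \[ \mathfrak{M}(G)=\min\{r\in\mathbb{N} : r\ge\chi(G)\text{ and } G\text{ is }k\text{-mixing for all integers }k\ge r\}, \] \[ \mathfrak{M}_c(G)=\inf\{r\in\mathbb{Q} : r\ge\chi_c(G)\text{ and } G\text{ is }(k,q)\text{-mixing for all integers }q\ge1,\ k\ge2q\text{ with }k/q\ge r\}. \] \textbf{Theorem.}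 Let $G$ be a graph that has at least one edge or at least three vertices. Then both sets above are nonempty (so that both thresholds are well defined), and \[ \mathfrak{M}_c(G)\le\max\left\{\frac{|V(G)|+1}{2},\ \mathfrak{M}(G)\right\}. \] -/

import Mathlib

namespace SimpleGraph

/-- The circular clique `G_{k,q}`: vertices `0, …, k-1`, with `ij` an edge when
`q ≤ |i - j| ≤ k - q`. It is only used for `q ≥ 1` and `k ≥ 2q`, where the clause `i ≠ j`
is automatic. -/
def circularClique (k q : ℕ) : SimpleGraph (Fin k) where
  Adj i j := i ≠ j ∧ (q : ℤ) ≤ |(i : ℤ) - (j : ℤ)| ∧ |(i : ℤ) - (j : ℤ)| ≤ (k : ℤ) - (q : ℤ)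
  symm := ⟨fun i j h => by
    rw [abs_sub_comm (j : ℤ) (i : ℤ)]
    exact ⟨h.1.symm, h.2⟩⟩
  loopless := ⟨fun i h => h.1 rfl⟩

/-- The `H`-colour graph of `G`: its vertices are the homomorphisms `G → H`, and two of them are
adjacent when they differ at exactly one vertex of `G`. -/
def colourGraph {V W : Type*} (G : SimpleGraph V) (H : SimpleGraph W) : SimpleGraph (G →g H) where
  Adj f g := ∃! v : V, f v ≠ g v
  symm := ⟨fun f g h => by simpa only [ne_comm] using h⟩
  loopless := ⟨fun f h => by
    obtain ⟨v, hv, -⟩ := h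
    exact hv rfl⟩

/-- `G` is `H`-mixing when the `H`-colour graph of `G` is connected. -/
def IsHomMixing {V W : Type*} (G : SimpleGraph V) (H : SimpleGraph W) : Prop :=
  (G.colourGraph H).Connected

/-- `G` is `k`-mixing: the graph of its proper `k`-colourings, i.e. of the homomorphisms
`G → K_k`, is connected. -/
def IsMixing {V : Type*} (G : SimpleGraph V) (k : ℕ) : Prop :=
  G.IsHomMixing (completeGraph (Fin k))

/-- `G` is `(k,q)`-mixing. -/
def IsCircularMixing {V : Type*} (G : SimpleGraph V) (k q : ℕ) : Prop :=
  G.IsHomMixing (circularClique k q)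

/-- The circular chromatic number `inf {k/q : k ≥ 2q ≥ 2, G → G_{k,q}}`. -/
noncomputable def circularChromaticNumber {V : Type*} (G : SimpleGraph V) : ℝ :=
  sInf {x : ℝ | ∃ k q : ℕ, 1 ≤ q ∧ 2 * q ≤ k ∧ Nonempty (G →g circularClique k q) ∧
    x = (k : ℝ) / (q : ℝ)}

/-- The natural numbers `r ≥ χ(G)` such that `G` is `k`-mixing for all `k ≥ r`. -/
def mixingBounds {V : Type*} (G : SimpleGraph V) : Set ℕ :=
  {r : ℕ | G.chromaticNumber ≤ (r : ℕ∞) ∧ ∀ k : ℕ, r ≤ k → G.IsMixing k}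

/-- The mixing threshold. -/
noncomputable def mixingThreshold {V : Type*} (G : SimpleGraph V) : ℕ :=
  sInf G.mixingBounds

/-- The rational numbers `r ≥ χ_c(G)` such that `G` is `(k,q)`-mixing for all `k/q ≥ r`
(`k, q` not necessarily coprime). -/
def circularMixingBounds {V : Type*} (G : SimpleGraph V) : Set ℚ :=
  {r : ℚ | G.circularChromaticNumber ≤ (r : ℝ) ∧
    ∀ k q : ℕ, 1 ≤ q → 2 * q ≤ k → r ≤ (k : ℚ) / (q : ℚ) → G.IsCircularMixing k q}

/-- The circular mixing threshold, a real number: the infimum in `ℝ` of a set of rationals. -/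
noncomputable def circularMixingThreshold {V : Type*} (G : SimpleGraph V) : ℝ :=
  sInf ((fun r : ℚ => (r : ℝ)) '' G.circularMixingBounds)

end SimpleGraph

namespace SimpleGraph

variable {V W X : Type*}

/-! Write n = |V|, let k/q exceed both (n+1)/2 and the mixing threshold, and choose m with mq < k ≤
(m+1)q, so that G is m-mixing and (m+1)-mixing. It suffices to transform every (k,q)-colouring into
some v ↦ q·h(v) + c with h a proper m-colouring (`ReachesMultiples`): m-mixing then changes h at
will, and the slack mq < k allows c to be shifted.

By averaging, nq < 2k gives q cyclically consecutive colours, a window, used by at most one vertex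
w. Rotate the window to [0,q). If it is empty, all colours round down to multiples of q. Otherwise
there are two cases.

If k < (m+1)q, raise w to the colour q, pushing up whatever gets in the way. This fails only if an
increasing walk of length m leaves w. Reflecting the colours gives the same alternative in the
downward direction. If both directions are blocked, the two walks meet only in w, so n ≥ 2m+1,
against (n+1)q < 2k < 2(m+1)q.

If k = (m+1)q, all colours can be lowered into the residue class of w modulo q. The result is an
(m+1)-colouring in multiples of q, and (m+1)-mixing removes one colour.

The bound follows by letting rational r decrease to the maximum. -/

/-! ### Recolouring in a general colour graph -/

theorem colourGraph_reachable_of_forall_ne_eq {G : SimpleGraph V} {H : SimpleGraph W}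
    {f g : G →g H} (w : V) (h : ∀ v, v ≠ w → f v = g v) :
    (G.colourGraph H).Reachable f g := by
  by_cases hw : f w = g w
  · have : f = g := by
      ext v
      by_cases hv : v = w
      · rw [hv, hw]
      · exact h v hv
    rw [this]
  · refine Adj.reachable ⟨w, hw, fun v hv => ?_⟩
    by_contra hne
    exact hv (h v hne)

theorem colourGraph_reachable_comp {G : SimpleGraph V} {H : SimpleGraph W} {K : SimpleGraph X}
    (φ : H →g K) {f g : G →g H} (h : (G.colourGraph H).Reachable f g) :
    (G.colourGraph K).Reachable (φ.comp f) (φ.comp g) := by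
  obtain ⟨p⟩ := h
  induction p with
  | nil => exact Reachable.refl _
  | cons hadj _ ih =>
    obtain ⟨w, -, hw⟩ := hadj
    refine (colourGraph_reachable_of_forall_ne_eq w fun v hv => ?_).trans ih
    have : ¬ _ := fun hne => hv (hw v hne)
    simpa using congrArg φ (not_not.1 this)

/-- If, in an order of the vertices given by a priority, the colours of `f` can be replaced by
those of `g` without a conflict, then `f` and `g` are joined in the colour graph. -/
theorem colourGraph_reachable_of_priority [Finite V] {G : SimpleGraph V} {H : SimpleGraph W}
    (f g : G →g H) (p : V → ℤ)
    (h : ∀ u v, G.Adj u v → p u ≤ p v → H.Adj (g u) (f v)) :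
    (G.colourGraph H).Reachable f g := by
  classical
  have := Fintype.ofFinite V
  induction hn : (Finset.univ.filter fun v => f v ≠ g v).card using Nat.strong_induction_on
    generalizing f with
  | _ n ih =>
  rcases (Finset.univ.filter fun v => f v ≠ g v).eq_empty_or_nonempty with he | he
  · have : f = g := by
      ext v
      by_contra hv
      have : v ∈ (Finset.univ.filter fun v => f v ≠ g v) := by simpa using hv
      simp [he] at this
    rw [this]
  -- For w of least priority among the disagreements, each neighbour either already has its final
  -- colour or has priority at least that of w, so w can be recoloured now.
  obtain ⟨w, hw, hmin⟩ := Finset.exists_min_image _ p he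
  have hw' : f w ≠ g w := by simpa using hw
  have key : ∀ u, G.Adj w u → H.Adj (g w) (f u) := by
    intro u hu
    by_cases hfu : f u = g u
    · rw [hfu]; exact g.map_adj hu
    · exact h w u hu (hmin u (by simpa using hfu))
  let f' : G →g H :=
    { toFun := Function.update f w (g w)
      map_rel' := by
        intro a b hab
        by_cases ha : a = w
        · subst ha
          rw [Function.update_self, Function.update_of_ne hab.ne']
          exact key b hab
        · by_cases hb : b = w
          · subst hb
            rw [Function.update_self, Function.update_of_ne ha]
            exact (key a hab.symm).symm
          · rw [Function.update_of_ne ha, Function.update_of_ne hb]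
            exact f.map_adj hab }
  have hf'w : f' w = g w := Function.update_self (f := f) w (g w)
  have hf' : ∀ v, v ≠ w → f' v = f v := fun v hv => Function.update_of_ne (f := f) hv (g w)
  refine (colourGraph_reachable_of_forall_ne_eq w fun v hv => (hf' v hv).symm).trans
    (ih _ ?_ f' ?_ rfl)
  · rw [← hn]
    apply Finset.card_lt_card
    rw [Finset.ssubset_iff_of_subset]
    · exact ⟨w, hw, by simp [hf'w]⟩
    · intro v hv
      have hv' : f' v ≠ g v := by simpa using hv
      have hne : v ≠ w := fun e => hv' (by rw [e, hf'w])
      simpa [hf' v hne] using hv'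
  · intro u v huv hp
    by_cases hv : v = w
    · subst hv; rw [hf'w]; exact g.map_adj huv
    · rw [hf' v hv]; exact h u v huv hp

/-! ### Circular colourings as integer functions modulo k -/

/-- An integer-valued function that is a `(k,q)`-colouring when read modulo `k`. -/
def IsCircularColouring (G : SimpleGraph V) (k q : ℕ) (F : V → ℤ) : Prop :=
  ∀ u v, G.Adj u v → ∃ n : ℤ, (q : ℤ) ≤ F u - F v + n * k ∧ F u - F v + n * k ≤ (k : ℤ) - q

theorem circularClique_adj_of_int {k q : ℕ} (hq : 1 ≤ q) {i j : Fin k} {n : ℤ}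
    (h1 : (q : ℤ) ≤ (i : ℤ) - j + n * k) (h2 : (i : ℤ) - j + n * k ≤ (k : ℤ) - q) :
    (circularClique k q).Adj i j := by
  have hi := i.2
  have hj := j.2
  have hn1 : -1 < n := by
    by_contra hn
    nlinarith
  have hn2 : n < 2 := by
    by_contra hn
    nlinarith
  have : (q : ℤ) ≤ |(i : ℤ) - (j : ℤ)| ∧ |(i : ℤ) - (j : ℤ)| ≤ (k : ℤ) - (q : ℤ) := by
    obtain rfl | rfl : n = 0 ∨ n = 1 := by omega
    · rw [abs_of_nonneg (by omega)]; omega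
    · rw [abs_of_nonpos (by omega)]; omega
  refine ⟨fun e => ?_, this⟩
  subst e
  simp at this
  omega

/-- The homomorphism to the circular clique obtained by reducing integer colours modulo `k`. -/
def circularHom {G : SimpleGraph V} {k q : ℕ} (hk : 0 < k) (hq : 1 ≤ q) (F : V → ℤ)
    (hF : G.IsCircularColouring k q F) : G →g circularClique k q where
  toFun v := ⟨(F v % k).toNat, by
    have := Int.emod_lt_of_pos (F v) (b := k) (by omega)
    have := Int.emod_nonneg (F v) (b := k) (by omega)
    omega⟩
  map_rel' := by
    intro u v huv
    obtain ⟨n, h1, h2⟩ := hF u v huv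
    have hu := Int.emod_add_mul_ediv (F u) k
    have hv := Int.emod_add_mul_ediv (F v) k
    have e : (((F u % k).toNat : ℕ) : ℤ) - (((F v % k).toNat : ℕ) : ℤ)
        + (n + F u / k - F v / k) * k = F u - F v + n * k := by
      rw [Int.toNat_of_nonneg (Int.emod_nonneg _ (by omega)),
        Int.toNat_of_nonneg (Int.emod_nonneg _ (by omega))]
      linear_combination hu - hv
    exact circularClique_adj_of_int hq (n := n + F u / k - F v / k)
      (by rw [e]; exact h1) (by rw [e]; exact h2)

theorem circularHom_congr {G : SimpleGraph V} {k q : ℕ} (hk : 0 < k) (hq : 1 ≤ q) {F F' : V → ℤ}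
    (hF : G.IsCircularColouring k q F) (hF' : G.IsCircularColouring k q F')
    (h : ∀ v, F v % k = F' v % k) : circularHom hk hq F hF = circularHom hk hq F' hF' := by
  ext v
  simp [circularHom, h v]

theorem isCircularColouring_val {G : SimpleGraph V} {k q : ℕ} (f : G →g circularClique k q) :
    G.IsCircularColouring k q (fun v => (f v : ℤ)) := by
  intro u v huv
  obtain ⟨-, h1, h2⟩ := f.map_adj huv
  rcases abs_cases ((f u : ℤ) - (f v : ℤ)) with ⟨h, -⟩ | ⟨h, -⟩
  · exact ⟨0, by dsimp only; omega, by dsimp only; omega⟩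
  · exact ⟨1, by dsimp only; omega, by dsimp only; omega⟩

theorem circularHom_val {G : SimpleGraph V} {k q : ℕ} (hk : 0 < k) (hq : 1 ≤ q)
    (f : G →g circularClique k q) :
    circularHom hk hq (fun v => (f v : ℤ)) (isCircularColouring_val f) = f := by
  ext v
  have : ((f v : ℕ) : ℤ) % k = (f v : ℕ) :=
    Int.emod_eq_of_lt (by omega) (by have := (f v).2; omega)
  simp [circularHom, this]

/-- Two integer-valued functions represent `(k,q)`-colourings joined in the colour graph. -/
def CircularReachable (G : SimpleGraph V) (k q : ℕ) (F F' : V → ℤ) : Prop :=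
  ∃ (hk : 0 < k) (hq : 1 ≤ q) (hF : G.IsCircularColouring k q F)
    (hF' : G.IsCircularColouring k q F'),
    (G.colourGraph (circularClique k q)).Reachable (circularHom hk hq F hF)
      (circularHom hk hq F' hF')

namespace CircularReachable

variable {G : SimpleGraph V} {k q : ℕ} {F F' F'' : V → ℤ}

theorem symm (h : G.CircularReachable k q F F') : G.CircularReachable k q F' F := by
  obtain ⟨hk, hq, hF, hF', h⟩ := h
  exact ⟨hk, hq, hF', hF, h.symm⟩

theorem trans (h : G.CircularReachable k q F F') (h' : G.CircularReachable k q F' F'') :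
    G.CircularReachable k q F F'' := by
  obtain ⟨hk, hq, hF, hF', h⟩ := h
  obtain ⟨_, _, _, hF'', h'⟩ := h'
  exact ⟨hk, hq, hF, hF'', h.trans h'⟩

end CircularReachable

theorem IsCircularColouring.congr {G : SimpleGraph V} {k q : ℕ} {F F' : V → ℤ}
    (hF : G.IsCircularColouring k q F) (h : ∀ v, F v % k = F' v % k) :
    G.IsCircularColouring k q F' := by
  intro u v huv
  obtain ⟨n, h1, h2⟩ := hF u v huv
  obtain ⟨a, ha⟩ := (Int.ModEq.dvd (h u) : (k : ℤ) ∣ F' u - F u)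
  obtain ⟨b, hb⟩ := (Int.ModEq.dvd (h v) : (k : ℤ) ∣ F' v - F v)
  have e : F' u - F' v + (n - a + b) * k = F u - F v + n * k := by
    linear_combination ha - hb
  exact ⟨n - a + b, by rw [e]; exact h1, by rw [e]; exact h2⟩

theorem CircularReachable.of_emod_eq {G : SimpleGraph V} {k q : ℕ} (hk : 0 < k) (hq : 1 ≤ q)
    {F F' : V → ℤ} (hF : G.IsCircularColouring k q F) (h : ∀ v, F v % k = F' v % k) :
    G.CircularReachable k q F F' :=
  ⟨hk, hq, hF, hF.congr h, by rw [circularHom_congr hk hq hF (hF.congr h) h]⟩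

theorem IsCircularColouring.affine {G : SimpleGraph V} {k q : ℕ} {F : V → ℤ}
    (hF : G.IsCircularColouring k q F) {s : ℤ} (hs : s = 1 ∨ s = -1) (c : ℤ) :
    G.IsCircularColouring k q fun v => s * F v + c := by
  intro u v huv
  obtain ⟨n, h1, h2⟩ := hF u v huv
  rcases hs with rfl | rfl
  · exact ⟨n, by linarith, by linarith⟩
  · exact ⟨1 - n, by linarith, by linarith⟩

/-- Rotations and reflections are endomorphisms of the circular clique, and composition with them
preserves paths of colourings. This is what permits normalising the window to [0,q) and reversing
direction. -/
theorem CircularReachable.affine {G : SimpleGraph V} {k q : ℕ} {F F' : V → ℤ}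
    (h : G.CircularReachable k q F F') {s : ℤ} (hs : s = 1 ∨ s = -1) (c : ℤ) :
    G.CircularReachable k q (fun v => s * F v + c) (fun v => s * F' v + c) := by
  obtain ⟨hk, hq, hF, hF', h⟩ := h
  let φ : circularClique k q →g circularClique k q :=
    circularHom hk hq _ ((isCircularColouring_val Hom.id).affine hs c)
  have key : ∀ (E : V → ℤ) (hE : G.IsCircularColouring k q E),
      φ.comp (circularHom hk hq E hE) = circularHom hk hq _ (hE.affine hs c) := by
    intro E hE
    ext v
    have h0 : 0 ≤ E v % k := Int.emod_nonneg _ (by omega)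
    have : (s * (E v % k) + c) % k = (s * E v + c) % k := by
      rw [Int.add_emod, Int.mul_emod, Int.emod_emod, ← Int.mul_emod, ← Int.add_emod]
    simp [φ, circularHom, h0, this]
  refine ⟨hk, hq, hF.affine hs c, hF'.affine hs c, ?_⟩
  rw [← key F hF, ← key F' hF']
  exact colourGraph_reachable_comp φ h

theorem CircularReachable.of_priority [Finite V] {G : SimpleGraph V} {k q : ℕ} (hk : 0 < k)
    (hq : 1 ≤ q) {F F' : V → ℤ} (hF : G.IsCircularColouring k q F)
    (hF' : G.IsCircularColouring k q F') (p : V → ℤ)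
    (h : ∀ u v, G.Adj u v → p u ≤ p v →
      ∃ n : ℤ, (q : ℤ) ≤ F' u - F v + n * k ∧ F' u - F v + n * k ≤ (k : ℤ) - q) :
    G.CircularReachable k q F F' := by
  refine ⟨hk, hq, hF, hF', colourGraph_reachable_of_priority _ _ p fun u v huv hp => ?_⟩
  obtain ⟨n, h1, h2⟩ := h u v huv hp
  have hu := Int.emod_add_mul_ediv (F' u) k
  have hv := Int.emod_add_mul_ediv (F v) k
  have e : (((F' u % k).toNat : ℕ) : ℤ) - (((F v % k).toNat : ℕ) : ℤ)
      + (n + F' u / k - F v / k) * k = F' u - F v + n * k := by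
    rw [Int.toNat_of_nonneg (Int.emod_nonneg _ (by omega)),
      Int.toNat_of_nonneg (Int.emod_nonneg _ (by omega))]
    linear_combination hu - hv
  exact circularClique_adj_of_int hq (n := n + F' u / k - F v / k)
    (by rw [← e] at h1; exact h1) (by rw [← e] at h2; exact h2)

/-- Distances along the integers, for a colouring with values in one period. -/
theorem IsCircularColouring.le_sub {G : SimpleGraph V} {k q : ℕ} (hq : 1 ≤ q) {F : V → ℤ}
    (hF : G.IsCircularColouring k q F) (h0 : ∀ v, 0 ≤ F v) (hlt : ∀ v, F v < k) {u v : V}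
    (huv : G.Adj u v) (hle : F u ≤ F v) : (q : ℤ) ≤ F v - F u ∧ F v - F u ≤ (k : ℤ) - q := by
  obtain ⟨n, h1, h2⟩ := hF v u huv.symm
  have := h0 u; have := h0 v; have := hlt u; have := hlt v
  have hn1 : -1 < n := by
    by_contra hn
    nlinarith
  have hn2 : n < 1 := by
    by_contra hn
    nlinarith
  obtain rfl : n = 0 := by omega
  constructor <;> linarith

theorem IsCircularColouring.of_le_sub {G : SimpleGraph V} {k q : ℕ} {F E : V → ℤ}
    (h : ∀ u v, G.Adj u v → E u ≤ E v → (q : ℤ) ≤ F v - F u ∧ F v - F u ≤ (k : ℤ) - q) :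
    G.IsCircularColouring k q F := by
  intro u v huv
  rcases le_total (E u) (E v) with hle | hle
  · have := h u v huv hle
    exact ⟨1, by linarith, by linarith⟩
  · have := h v u huv.symm hle
    exact ⟨0, by linarith, by linarith⟩

/-! ### Colourings by multiples of q -/

/-- The colouring `F` can be transformed into one coming from a proper `m`-colouring whose
colours are spread out at distance `q`. -/
def ReachesMultiples (G : SimpleGraph V) (k q m : ℕ) (F : V → ℤ) : Prop :=
  ∃ (h : G →g completeGraph (Fin m)) (c : ℤ),
    G.CircularReachable k q F fun v => q * (h v : ℤ) + c

theorem ReachesMultiples.of_reachable {G : SimpleGraph V} {k q m : ℕ} {F F' : V → ℤ}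
    (h : G.CircularReachable k q F F') (h' : G.ReachesMultiples k q m F') :
    G.ReachesMultiples k q m F := by
  obtain ⟨f, c, hf⟩ := h'
  exact ⟨f, c, h.trans hf⟩

theorem ReachesMultiples.affine {G : SimpleGraph V} {k q m : ℕ} {F : V → ℤ}
    (h : G.ReachesMultiples k q m F) {s : ℤ} (hs : s = 1 ∨ s = -1) (c : ℤ) :
    G.ReachesMultiples k q m fun v => s * F v + c := by
  obtain ⟨f, c', hf⟩ := h
  have hf' := hf.affine hs c
  rcases hs with rfl | rfl
  · refine ⟨f, c' + c, ?_⟩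
    convert hf' using 2
    ring
  · refine ⟨{ toFun := fun v => (f v).rev, map_rel' := fun {u v} huv e => ?_ },
      c - c' - q * (m - 1), ?_⟩
    · exact f.map_adj huv (Fin.rev_injective e)
    · convert hf' using 2 with v
      have : (((f v).rev : ℕ) : ℤ) = m - 1 - (f v : ℕ) := by
        have := (f v).2
        rw [Fin.val_rev]
        omega
      simp only [RelHom.coeFn_mk, this]
      ring

theorem isCircularColouring_completeGraph {k q N : ℕ} (hN : N * q ≤ k) (c : ℤ) :
    (completeGraph (Fin N)).IsCircularColouring k q fun i => q * (i : ℤ) + c := by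
  refine IsCircularColouring.of_le_sub (E := fun i => (i : ℤ)) fun i j hij hle => ?_
  have hne : (i : ℕ) ≠ j := fun e => hij (Fin.ext e)
  have h1 : ((i : ℕ) : ℤ) + 1 ≤ (j : ℕ) := by omega
  have h2 : ((j : ℕ) : ℤ) + 1 ≤ N := by have := j.2; omega
  have h3 : (N : ℤ) * q ≤ k := by exact_mod_cast hN
  constructor <;> nlinarith

theorem isCircularColouring_multiples {G : SimpleGraph V} {k q N : ℕ} (hN : N * q ≤ k)
    (f : G →g completeGraph (Fin N)) (c : ℤ) :
    G.IsCircularColouring k q fun v => q * (f v : ℤ) + c :=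
  fun _ _ huv => isCircularColouring_completeGraph hN c _ _ (f.map_adj huv)

/-- The map i ↦ qi + c embeds the complete graph on N vertices in the circular clique, so a path of
N-colourings is carried over. -/
theorem IsMixing.circularReachable {G : SimpleGraph V} {k q N : ℕ} (hk : 0 < k) (hq : 1 ≤ q)
    (hN : N * q ≤ k) (hG : G.IsMixing N) (f g : G →g completeGraph (Fin N)) (c : ℤ) :
    G.CircularReachable k q (fun v => q * (f v : ℤ) + c) fun v => q * (g v : ℤ) + c :=
  ⟨hk, hq, isCircularColouring_multiples hN f c, isCircularColouring_multiples hN g c,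
    colourGraph_reachable_comp (circularHom hk hq _ (isCircularColouring_completeGraph hN c))
      (hG.preconnected f g)⟩

/-- Since mq < k, there is at least one spare colour above the top class; the classes advance by 1
one after another, from the top down. -/
theorem circularReachable_multiples_add [Finite V] {G : SimpleGraph V} {k q m : ℕ} (hq : 1 ≤ q)
    (hm : m * q < k) (f : G →g completeGraph (Fin m)) (c c' : ℤ) :
    G.CircularReachable k q (fun v => q * (f v : ℤ) + c) fun v => q * (f v : ℤ) + c' := by
  have hk : 0 < k := by omega
  have step : ∀ c : ℤ, G.CircularReachable k q (fun v => q * (f v : ℤ) + c)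
      fun v => q * (f v : ℤ) + (c + 1) := by
    intro c
    refine .of_priority hk hq (isCircularColouring_multiples hm.le f c)
      (isCircularColouring_multiples hm.le f _) (fun v => -(f v : ℤ)) fun u v huv hp => ?_
    have hne : ((f u : ℕ)) ≠ f v := fun e => f.map_adj huv (Fin.ext e)
    have h1 : ((f v : ℕ) : ℤ) + 1 ≤ (f u : ℕ) := by omega
    have h2 : ((f u : ℕ) : ℤ) + 1 ≤ m := by have := (f u).2; omega
    have h3 : (m : ℤ) * q + 1 ≤ k := by exact_mod_cast hm
    exact ⟨0, by nlinarith, by nlinarith⟩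
  have main : ∀ (c : ℤ) (n : ℕ), G.CircularReachable k q (fun v => q * (f v : ℤ) + c)
      fun v => q * (f v : ℤ) + (c + n) := by
    intro c n
    induction n with
    | zero =>
      exact .of_emod_eq hk hq (isCircularColouring_multiples hm.le f c) fun v => by simp
    | succ n ih =>
      refine ih.trans ?_
      have := step (c + n)
      push_cast
      rwa [add_assoc] at this
  rcases le_total c c' with h | h
  · have := main c (c' - c).toNat
    rwa [Int.toNat_of_nonneg (by omega), add_sub_cancel] at this
  · have := main c' (c - c').toNat
    rw [Int.toNat_of_nonneg (by omega), add_sub_cancel] at this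
    exact this.symm

/-- A colouring that avoids `q` consecutive colours can be rounded to multiples of `q`. -/
theorem reachesMultiples_of_window_empty [Finite V] {G : SimpleGraph V} {k q m : ℕ} (hq : 1 ≤ q)
    (hm : m * q < k) (hmk : k ≤ (m + 1) * q) {F : V → ℤ} (hF : G.IsCircularColouring k q F)
    (h0 : ∀ v, q ≤ F v) (hlt : ∀ v, F v < k) : G.ReachesMultiples k q m F := by
  have hmk' : (k : ℤ) ≤ (m + 1) * q := by exact_mod_cast hmk
  have hq0 : (0 : ℤ) < q := by omega
  have hdist := fun u v => hF.le_sub hq (fun v => by have := h0 v; omega) hlt (u := u) (v := v)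
  have hdiv0 : ∀ v, 0 ≤ (F v - q) / q := fun v => Int.ediv_nonneg (by have := h0 v; omega) hq0.le
  have hdivm : ∀ v, (F v - q) / q < m := fun v => by
    rw [Int.ediv_lt_iff_lt_mul hq0]
    have := hlt v
    linarith
  have hmod0 : ∀ v, q * ((F v - q) / q) + q ≤ F v := fun v => by
    have := Int.mul_ediv_self_le (x := F v - q) hq0.ne'
    linarith
  have hmod1 : ∀ v, F v < q * ((F v - q) / q) + 2 * q := fun v => by
    have := Int.lt_mul_ediv_self_add (x := F v - q) hq0
    linarith
  have hstep : ∀ u v, G.Adj u v → F u ≤ F v → (F u - q) / q + 1 ≤ (F v - q) / q := by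
    intro u v huv hle
    have := (hdist u v huv hle).1
    rw [Int.le_ediv_iff_mul_le hq0]
    have := hmod0 u
    linarith
  let f : G →g completeGraph (Fin m) :=
    { toFun := fun v => ⟨((F v - q) / q).toNat, by have := hdiv0 v; have := hdivm v; omega⟩
      map_rel' := by
        intro u v huv e
        have e' : ((F u - q) / q).toNat = ((F v - q) / q).toNat := congrArg Fin.val e
        have := hdiv0 u
        have := hdiv0 v
        rcases le_total (F u) (F v) with hle | hle
        · have := hstep u v huv hle
          omega
        · have := hstep v u huv.symm hle
          omega }
  have hf : ∀ v, ((f v : ℕ) : ℤ) = (F v - q) / q := fun v => Int.toNat_of_nonneg (hdiv0 v)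
  -- Each vertex is rounded down in increasing order of F: larger neighbours have not moved yet, and
  -- the empty window [0,q) prevents a conflict around the cycle.
  refine ⟨f, q, .of_priority (by omega) hq hF (isCircularColouring_multiples hm.le f q) F
    fun u v huv hle => ?_⟩
  have h1 := hdist u v huv hle
  have h2 := hmod0 u
  have h3 := hlt v
  have h4 := mul_nonneg hq0.le (hdiv0 u)
  simp only [hf]
  exact ⟨1, by linarith, by linarith⟩

/-! ### Pushing a single vertex out of the window -/

/-- There is a walk of length `j` from `w` to `v` along which the colours increase. -/
def IncreasingWalk (G : SimpleGraph V) (F : V → ℤ) (w : V) (j : ℕ) (v : V) : Prop :=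
  ∃ c : ℕ → V, c 0 = w ∧ c j = v ∧ ∀ i < j, G.Adj (c i) (c (i + 1)) ∧ F (c i) < F (c (i + 1))

theorem increasingWalk_zero {G : SimpleGraph V} {F : V → ℤ} {w : V} : G.IncreasingWalk F w 0 w :=
  ⟨fun _ => w, rfl, rfl, fun i hi => absurd hi (Nat.not_lt_zero i)⟩

theorem IncreasingWalk.succ {G : SimpleGraph V} {F : V → ℤ} {w u v : V} {j : ℕ}
    (h : G.IncreasingWalk F w j u) (huv : G.Adj u v) (hlt : F u < F v) :
    G.IncreasingWalk F w (j + 1) v := by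
  classical
  obtain ⟨c, h0, hj, hc⟩ := h
  refine ⟨fun i => if i ≤ j then c i else v, by simp [h0], by simp, fun i hi => ?_⟩
  rcases Nat.lt_succ_iff_lt_or_eq.1 hi with hi' | rfl
  · simpa [hi'.le, Nat.succ_le_of_lt hi'] using hc i hi'
  · simpa [hj] using ⟨huv, hlt⟩

theorem add_mul_le_of_increasing {F : ℕ → ℤ} {q : ℤ} {a b : ℕ} (hab : a ≤ b)
    (h : ∀ i, a ≤ i → i < b → F i + q ≤ F (i + 1)) : F a + (b - a) * q ≤ F b := by
  induction b, hab using Nat.le_induction with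
  | base => simp
  | succ b hb ih =>
    have h1 := ih fun i hi hi' => h i hi (by omega)
    have h2 := h b hb (by omega)
    push_cast
    linarith

theorem IncreasingWalk.add_le {G : SimpleGraph V} {F : V → ℤ} {w v : V} {j q : ℕ}
    (hdist : ∀ u v, G.Adj u v → F u ≤ F v → (q : ℤ) ≤ F v - F u)
    (h : G.IncreasingWalk F w j v) : F w + j * q ≤ F v := by
  obtain ⟨c, rfl, rfl, hc⟩ := h
  have := add_mul_le_of_increasing (F := fun i => F (c i)) (q := q) (Nat.zero_le j)
    fun i _ hi => by
      have := hdist _ _ (hc i hi).1 (hc i hi).2.le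
      linarith
  simpa using this

/-- If only the vertex `w` has a colour below `q`, then `w` can be raised to the colour `q`,
unless there is a long walk from `w` with increasing colours. -/
theorem reachesMultiples_of_not_increasingWalk [Finite V] {G : SimpleGraph V} {k q m : ℕ}
    (hq : 1 ≤ q) (hm1 : 1 ≤ m) (hm : m * q < k) (hmk : k ≤ (m + 1) * q) {F : V → ℤ}
    (hF : G.IsCircularColouring k q F) (w : V) (hw0 : 0 ≤ F w) (hwq : F w < q)
    (h0 : ∀ v, v ≠ w → q ≤ F v) (hlt : ∀ v, F v < k)
    (hwalk : ∀ v, ¬ G.IncreasingWalk F w m v) : G.ReachesMultiples k q m F := by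
  classical
  have hk : 0 < k := by omega
  have hm' : (m : ℤ) * q + 1 ≤ k := by exact_mod_cast hm
  have hq0 : (1 : ℤ) ≤ q := by omega
  have hnonneg : ∀ v, 0 ≤ F v := fun v => by
    by_cases hv : v = w
    · rwa [hv]
    · have := h0 v hv; omega
  have hdist := fun u v => hF.le_sub hq hnonneg hlt (u := u) (v := v)
  have hFwalk : ∀ {j v}, G.IncreasingWalk F w j v → F w + j * q ≤ F v := fun h =>
    h.add_le fun u v huv hle => (hdist u v huv hle).1
  -- E t is the colouring after w has been raised to t: an increasing walk of length j from w forces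
  -- its end up to at least jq + t. Only j < m matters, by `hwalk`, so the forced colours stay at
  -- most mq < k when t ≤ q.
  have hex : ∀ (t : ℕ) (v : V), ∃ x : ℤ, F v ≤ x ∧
      (∀ j < m, G.IncreasingWalk F w j v → (j : ℤ) * q + t ≤ x) ∧
      (x = F v ∨ ∃ j < m, G.IncreasingWalk F w j v ∧ x = j * q + t) := by
    intro t v
    let S : Finset ℤ := insert (F v)
      (((Finset.range m).filter fun j => G.IncreasingWalk F w j v).image
        fun j : ℕ => (j : ℤ) * q + t)
    have hS : S.Nonempty := Finset.insert_nonempty _ _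
    refine ⟨S.max' hS, S.le_max' _ (Finset.mem_insert_self _ _), fun j hj hjv => ?_, ?_⟩
    · refine S.le_max' _ (Finset.mem_insert_of_mem (Finset.mem_image_of_mem _ ?_))
      simp [hj, hjv]
    · rcases Finset.mem_insert.1 (S.max'_mem hS) with h | h
      · exact Or.inl h
      · obtain ⟨j, hj, e⟩ := Finset.mem_image.1 h
        rw [Finset.mem_filter, Finset.mem_range] at hj
        exact Or.inr ⟨j, hj.1, hj.2, e.symm⟩
  choose E hFE hlow hE using hex
  have hEw : ∀ t : ℕ, F w ≤ t → E t w = t := by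
    intro t ht
    have h1 := hlow t w 0 (by omega) increasingWalk_zero
    rcases hE t w with h | ⟨j, -, hj, h⟩
    · push_cast at h1; linarith
    · have := hFwalk hj
      have hj0 : j = 0 := by
        by_contra hne
        have : (1 : ℤ) ≤ j := by omega
        nlinarith
      subst hj0
      simpa using h
  have hEk : ∀ t : ℕ, t ≤ q → ∀ v, E t v < k := by
    intro t ht v
    rcases hE t v with h | ⟨j, hj, -, h⟩
    · rw [h]; exact hlt v
    · have : (j : ℤ) + 1 ≤ m := by omega
      have : (t : ℤ) ≤ q := by omega
      nlinarith
  -- Two parameters serve two purposes here and in `hEdown`: t = t' shows that E t is a colouring,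
  -- and t = t' + 1 that E t' can be changed into E t from the top down.
  have hEup : ∀ t t' : ℕ, t' ≤ t → ∀ u v, G.Adj u v → F u ≤ F v → (q : ℤ) ≤ E t v - E t' u := by
    intro t t' ht u v huv hle
    have hd := hdist u v huv hle
    rcases hE t' u with h | ⟨j, hj, hju, h⟩
    · have := hFE t v
      linarith
    · have hs := hju.succ huv (by linarith)
      have hj1 : j + 1 < m := by
        refine lt_of_le_of_ne hj fun e => hwalk v (e ▸ hs)
      have := hlow t v (j + 1) hj1 hs
      push_cast at this
      have : (t' : ℤ) ≤ t := by omega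
      linarith
  have hEdown : ∀ t t' : ℕ, t ≤ t' + 1 → t ≤ q → F w ≤ t' → ∀ u v, G.Adj u v → F u ≤ F v →
      E t v - E t' u ≤ (k : ℤ) - q := by
    intro t t' ht htq hwt u v huv hle
    have hd := hdist u v huv hle
    by_cases hu : u = w
    · subst hu
      rw [hEw t' hwt]
      rcases hE t v with h | ⟨j, hj, -, h⟩
      · linarith
      · have : (j : ℤ) + 1 ≤ m := by omega
        -- The extra 1 is absorbed by mq + 1 ≤ k.
        have : (t : ℤ) ≤ t' + 1 := by omega
        nlinarith
    · have := h0 u hu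
      have := hFE t' u
      have := hEk t htq v
      linarith
  have hEcol : ∀ t : ℕ, t ≤ q → F w ≤ t → G.IsCircularColouring k q (E t) := fun t htq hwt =>
    IsCircularColouring.of_le_sub (E := F) fun u v huv hle =>
      ⟨hEup t t le_rfl u v huv hle, hEdown t t (by omega) htq hwt u v huv hle⟩
  have hreach : ∀ i : ℕ, (F w).toNat + i ≤ q →
      G.CircularReachable k q F (E ((F w).toNat + i)) := by
    intro i
    have hd : (((F w).toNat : ℕ) : ℤ) = F w := Int.toNat_of_nonneg hw0
    induction i with
    | zero =>
      intro _
      refine .of_emod_eq hk hq hF fun v => ?_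
      rcases hE ((F w).toNat + 0) v with h | ⟨j, -, hj, h⟩
      · rw [h]
      · have h1 := hFwalk hj
        have h2 := hFE ((F w).toNat + 0) v
        have : E ((F w).toNat + 0) v = F v := by
          push_cast at h
          linarith
        rw [this]
    | succ i ih =>
      intro hi
      refine (ih (by omega)).trans ?_
      refine .of_priority hk hq (hEcol _ (by omega) (by push_cast; omega))
        (hEcol _ hi (by push_cast; omega)) (fun v => -F v) fun u v huv hle => ?_
      have hle' : F v ≤ F u := by simpa using hle
      have h1 := hEup ((F w).toNat + (i + 1)) ((F w).toNat + i) (by omega) v u huv.symm hle'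
      have h2 := hEdown ((F w).toNat + (i + 1)) ((F w).toNat + i) (by omega) hi
        (by push_cast; omega) v u huv.symm hle'
      exact ⟨0, by linarith, by linarith⟩
  have hfin := hreach (q - (F w).toNat) (by omega)
  rw [Nat.add_sub_cancel' (by omega)] at hfin
  refine .of_reachable hfin (reachesMultiples_of_window_empty hq hm hmk
    (hEcol q le_rfl hwq.le) (fun v => ?_) (hEk q le_rfl))
  by_cases hv : v = w
  · rw [hv, hEw q hwq.le]
  · exact (h0 v hv).trans (hFE q v)

/-- As k < (m+1)q, a walk of length m has almost no slack: the i-th vertex after w on the upward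
walk has its colour in the i-th block [iq,(i+1)q), at offset at least F w. The reflected walk also
visits each of the blocks 1, …, m once, but at offset below F w. Hence the two walks share only w.
-/
theorem two_mul_add_one_le_card_of_increasingWalk [Fintype V] {G : SimpleGraph V} {k q m : ℕ}
    (hq : 1 ≤ q) (hmk : k < (m + 1) * q) {F F' : V → ℤ} {w x y : V}
    (hdist : ∀ u v, G.Adj u v → F u ≤ F v → (q : ℤ) ≤ F v - F u)
    (hdist' : ∀ u v, G.Adj u v → F' u ≤ F' v → (q : ℤ) ≤ F' v - F' u)
    (hwq : F w < q) (hw0 : 0 ≤ F w) (hlt : ∀ v, F v < k) (hlt' : ∀ v, F' v < k)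
    (hw' : F' w = q - 1 - F w) (hF' : ∀ v, v ≠ w → F' v = k + q - 1 - F v)
    (hx : G.IncreasingWalk F w m x) (hy : G.IncreasingWalk F' w m y) :
    2 * m + 1 ≤ Fintype.card V := by
  have hq0 : (1 : ℤ) ≤ q := by omega
  have hmk' : (k : ℤ) + 1 ≤ (m + 1) * q := by exact_mod_cast hmk
  obtain ⟨c, c0, -, hc⟩ := hx
  obtain ⟨b, b0, -, hb⟩ := hy
  have stepc : ∀ i < m, F (c i) + q ≤ F (c (i + 1)) := fun i hi => by
    have := hdist _ _ (hc i hi).1 (hc i hi).2.le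
    linarith
  have stepb : ∀ i < m, F' (b i) + q ≤ F' (b (i + 1)) := fun i hi => by
    have := hdist' _ _ (hb i hi).1 (hb i hi).2.le
    linarith
  have hc1 : ∀ j : ℕ, j ≤ m → F w + j * q ≤ F (c j) := fun j hj => by
    have := add_mul_le_of_increasing (F := fun i => F (c i)) (Nat.zero_le j)
      fun i _ hi => stepc i (by omega)
    simpa [c0] using this
  have hc2 : ∀ j : ℕ, j ≤ m → F (c j) ≤ k - 1 - (m - j) * q := fun j hj => by
    have := add_mul_le_of_increasing (F := fun i => F (c i)) hj
      fun i _ hi => stepc i (by omega)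
    have := hlt (c m)
    linarith
  have hb1 : ∀ j : ℕ, j ≤ m → q - 1 - F w + j * q ≤ F' (b j) := fun j hj => by
    have := add_mul_le_of_increasing (F := fun i => F' (b i)) (Nat.zero_le j)
      fun i _ hi => stepb i (by omega)
    simpa [b0, hw'] using this
  have hb2 : ∀ j : ℕ, j ≤ m → F' (b j) ≤ k - 1 - (m - j) * q := fun j hj => by
    have := add_mul_le_of_increasing (F := fun i => F' (b i)) hj
      fun i _ hi => stepb i (by omega)
    have := hlt' (b m)
    linarith
  have hbw : ∀ j : ℕ, j < m → F' (b (j + 1)) = k + q - 1 - F (b (j + 1)) := fun j hj => by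
    refine hF' _ fun e => ?_
    have := hb1 (j + 1) hj
    rw [e, hw'] at this
    push_cast at this
    nlinarith
  have hbl : ∀ j : ℕ, j < m → ((m : ℤ) - j) * q ≤ F (b (j + 1)) := fun j hj => by
    have := hb2 (j + 1) hj
    rw [hbw j hj] at this
    push_cast at this
    linarith
  have hbu : ∀ j : ℕ, j < m → F (b (j + 1)) ≤ k + F w - (j + 1) * q := fun j hj => by
    have := hb1 (j + 1) hj
    rw [hbw j hj] at this
    push_cast at this
    linarith
  have eq_of : ∀ i j a : ℤ, i * q ≤ a → a < (i + 1) * q → j * q ≤ a → a < (j + 1) * q →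
      i = j := by
    intro i j a h1 h2 h3 h4
    have : i < j + 1 := by nlinarith
    have : j < i + 1 := by nlinarith
    omega
  let e : Option (Fin m ⊕ Fin m) → V
    | none => w
    | some (.inl i) => c (i + 1)
    | some (.inr i) => b (i + 1)
  have hcl : ∀ i : Fin m, (((i : ℕ) : ℤ) + 1) * q + F w ≤ F (c (i + 1)) := fun i => by
    have := hc1 (i + 1) i.2
    push_cast at this
    linarith
  have hcu : ∀ i : Fin m, F (c (i + 1)) ≤ k - 1 - (m - (i + 1)) * q := fun i => by
    have := hc2 (i + 1) i.2
    push_cast at this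
    linarith
  have hi0 : ∀ i : Fin m, (1 : ℤ) ≤ (i : ℕ) + 1 := fun i => by omega
  have him : ∀ i : Fin m, (1 : ℤ) ≤ m - (i : ℕ) := fun i => by have := i.2; omega
  have he : Function.Injective e := by
    have hcw : ∀ i : Fin m, c (i + 1) ≠ w := fun i h => by
      have h1 := hcl i
      rw [h] at h1
      have := hi0 i
      nlinarith
    have hbw' : ∀ i : Fin m, b (i + 1) ≠ w := fun i h => by
      have h1 := hbl i i.2
      rw [h] at h1
      have := him i
      nlinarith
    have hcb : ∀ i j : Fin m, c (i + 1) ≠ b (j + 1) := fun i j h => by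
      have h1 := hcl i
      have h2 := hcu i
      have h3 := hbl j j.2
      have h4 := hbu j j.2
      rw [h] at h1 h2
      have h5 := eq_of (i + 1) (m - j) _ (by linarith) (by linarith) h3 (by linarith)
      have h6 : (m : ℤ) = i + 1 + j := by linarith
      have h7 : (m : ℤ) * q = (i + 1) * q + j * q := by rw [h6]; ring
      linarith
    rintro (_ | i | i) (_ | j | j) h
    · rfl
    · exact absurd h.symm (hcw j)
    · exact absurd h.symm (hbw' j)
    · exact absurd h (hcw i)
    · have h1 := hcl i
      have h2 := hcu i
      have h3 := hcl j
      have h4 := hcu j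
      have h' : c (i + 1) = c (j + 1) := h
      rw [h'] at h1 h2
      have h5 := eq_of (i + 1) (j + 1) _ (by linarith) (by linarith) (by linarith)
        (by linarith)
      have : i = j := Fin.ext (by omega)
      rw [this]
    · exact absurd h (hcb i j)
    · exact absurd h (hbw' i)
    · exact absurd h.symm (hcb j i)
    · have h1 := hbl i i.2
      have h2 := hbu i i.2
      have h3 := hbl j j.2
      have h4 := hbu j j.2
      have h' : b (i + 1) = b (j + 1) := h
      rw [h'] at h1 h2
      have h5 := eq_of (m - i) (m - j) _ h1 (by linarith) h3 (by linarith)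
      have : i = j := Fin.ext (by omega)
      rw [this]
  have := Fintype.card_le_of_injective e he
  simp only [Fintype.card_option, Fintype.card_sum, Fintype.card_fin] at this
  omega

/-! ### The case k = (m+1)q -/

/-- When `q` divides `k`, all colours can be moved into one residue class modulo `q`. -/
theorem reachesMultiples_of_dvd [Finite V] {G : SimpleGraph V} {k q m : ℕ} (hq : 1 ≤ q)
    (hmk : k = (m + 1) * q) {F : V → ℤ}
    (hF : G.IsCircularColouring k q F) (w : V) (hw0 : 0 ≤ F w)
    (h0 : ∀ v, v ≠ w → q ≤ F v) (hlt : ∀ v, F v < k)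
    (hmix : G.IsMixing (m + 1)) (f₀ : G →g completeGraph (Fin m)) :
    G.ReachesMultiples k q m F := by
  have hk : 0 < k := by rw [hmk]; positivity
  have hq0 : (0 : ℤ) < q := by omega
  have hkm : (k : ℤ) = (m + 1) * q := by exact_mod_cast hmk
  have hnonneg : ∀ v, 0 ≤ F v := fun v => by
    by_cases hv : v = w
    · rwa [hv]
    · have := h0 v hv; omega
  obtain ⟨a, ha⟩ : ∃ a : V → ℤ, a = fun v => (F v - F w) / q := ⟨_, rfl⟩
  obtain ⟨ρ, hρ⟩ : ∃ ρ : V → ℤ, ρ = fun v => (F v - F w) % q := ⟨_, rfl⟩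
  have hFa : ∀ v, F v = q * a v + F w + ρ v := fun v => by
    have := Int.mul_ediv_add_emod (F v - F w) q
    rw [ha, hρ]
    linarith
  have hρ0 : ∀ v, 0 ≤ ρ v := fun v => by rw [hρ]; exact Int.emod_nonneg _ hq0.ne'
  have hρq : ∀ v, ρ v < q := fun v => by rw [hρ]; exact Int.emod_lt_of_pos _ hq0
  have hρw : ρ w = 0 := by simp [hρ]
  -- The difference of colours is a multiple of q minus ρ v - ρ u, so the quotients a differ by 1 to
  -- m modulo m + 1. The bound 2 leaves room for u to drop before v does; with equal residues it
  -- could fail only across the end of the period, where u would be w, of residue 0.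
  have key : ∀ u v, G.Adj u v → ρ u ≤ ρ v → ∃ n : ℤ, 1 ≤ a u - a v + n * (m + 1) ∧
      a u - a v + n * (m + 1) ≤ m ∧
      (F u ≤ F v → ρ u = ρ v → 0 < ρ v → 2 ≤ a u - a v + n * (m + 1)) ∧
      (ρ u < ρ v → 2 ≤ a u - a v + n * (m + 1)) := by
    intro u v huv hle
    obtain ⟨n, h1, h2⟩ := hF u v huv
    have e : F u - F v + n * k = (a u - a v + n * (m + 1)) * q + ρ u - ρ v := by
      rw [hFa u, hFa v, hkm]; ring
    have hu := hρ0 u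
    have hv := hρq v
    refine ⟨n, ?_, ?_, fun hFuv hρe hpos => ?_, fun hlt' => ?_⟩
    · rw [e] at h1
      by_contra hcon
      nlinarith
    · rw [e, hkm] at h2
      by_contra hcon
      nlinarith
    · by_contra hcon
      rw [e] at h1
      have hj : a u - a v + n * (m + 1) = 1 := by
        have : 0 < a u - a v + n * (m + 1) := by
          by_contra hcon'
          nlinarith
        omega
      rw [hj] at e
      have hFv := hlt v
      have hFu := hnonneg u
      have hn1 : 0 < n := by
        by_contra hcon'
        nlinarith
      have hn2 : n < 2 := by
        by_contra hcon'
        nlinarith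
      obtain rfl : n = 1 := by omega
      have hu : u = w := by
        by_contra hne
        have := h0 u hne
        linarith
      rw [hu, hρw] at hρe
      omega
    · rw [e] at h1
      by_contra hcon
      nlinarith
  have hG : G.IsCircularColouring k q fun v => q * a v + F w := by
    have aux : ∀ u v, G.Adj u v → ρ u ≤ ρ v → ∃ n : ℤ, (q : ℤ) ≤
        (q * a u + F w) - (q * a v + F w) + n * k ∧
        (q * a u + F w) - (q * a v + F w) + n * k ≤ (k : ℤ) - q := by
      intro u v huv hle
      obtain ⟨n, h1, h2, -, -⟩ := key u v huv hle
      have e : (q * a u + F w) - (q * a v + F w) + n * k = (a u - a v + n * (m + 1)) * q := by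
        rw [hkm]; ring
      exact ⟨n, by rw [e]; nlinarith, by rw [e, hkm]; nlinarith⟩
    intro u v huv
    rcases le_total (ρ u) (ρ v) with hle | hle
    · exact aux u v huv hle
    · obtain ⟨n, h1, h2⟩ := aux v u huv.symm hle
      exact ⟨1 - n, by linarith, by linarith⟩
  have hreach : G.CircularReachable k q F fun v => q * a v + F w := by
    -- The priority is lexicographic: first the residue, then the colour, as 0 ≤ F v < k.
    refine .of_priority hk hq hF hG (fun v => ρ v * k + F v) fun u v huv hp => ?_
    have hle : ρ u ≤ ρ v := by
      have := hnonneg u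
      have := hlt v
      by_contra hcon
      nlinarith
    by_cases hv : ρ v = 0
    · have hu : ρ u = 0 := le_antisymm (hle.trans hv.le) (hρ0 u)
      have : q * a u + F w = F u := by rw [hFa u, hu]; ring
      simp only [this]
      exact hF u v huv
    have hpos : 0 < ρ v := lt_of_le_of_ne (hρ0 v) (Ne.symm hv)
    obtain ⟨n, h1, h2, h3, h4⟩ := key u v huv hle
    have h5 : 2 ≤ a u - a v + n * (m + 1) := by
      rcases hle.lt_or_eq with h | h
      · exact h4 h
      · refine h3 ?_ h hpos
        rw [h] at hp
        linarith
    have e : (q * a u + F w) - F v + n * k = (a u - a v + n * (m + 1)) * q - ρ v := by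
      rw [hFa v, hkm]; ring
    have := hρq v
    exact ⟨n, by rw [e]; nlinarith, by rw [e, hkm]; nlinarith⟩
  have hm0 : (0 : ℤ) < m + 1 := by omega
  let f : G →g completeGraph (Fin (m + 1)) :=
    { toFun := fun v => ⟨(a v % (m + 1)).toNat, by
        have := Int.emod_lt_of_pos (a v) hm0
        omega⟩
      map_rel' := by
        have aux : ∀ u v, G.Adj u v → ρ u ≤ ρ v → a u % (m + 1) ≠ a v % (m + 1) := by
          intro u v huv hle h
          obtain ⟨n, h1, h2, -, -⟩ := key u v huv hle
          have h3 : ((m : ℤ) + 1) ∣ a u - a v := (Int.ModEq.dvd h.symm)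
          have h4 : ((m : ℤ) + 1) ∣ a u - a v + n * (m + 1) := h3.add (dvd_mul_left _ _)
          have := Int.le_of_dvd (by omega) h4
          omega
        intro u v huv e
        have e' : (a u % (m + 1)).toNat = (a v % (m + 1)).toNat := congrArg Fin.val e
        have hu := Int.emod_nonneg (a u) hm0.ne'
        have hv := Int.emod_nonneg (a v) hm0.ne'
        have e'' : a u % (m + 1) = a v % (m + 1) := by omega
        rcases le_total (ρ u) (ρ v) with hle | hle
        · exact aux u v huv hle e''
        · exact aux v u huv.symm hle e''.symm }
  let ι : completeGraph (Fin m) →g completeGraph (Fin (m + 1)) :=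
    { toFun := Fin.castSucc
      map_rel' := fun {i j} hij e => hij (Fin.castSucc_injective m e) }
  -- The target f₀ is viewed as an (m+1)-colouring that omits the last colour, so (m+1)-mixing
  -- reaches it.
  refine ⟨f₀, F w, hreach.trans (.trans (.of_emod_eq hk hq hG fun v => ?_)
    (hmix.circularReachable hk hq hmk.ge f (ι.comp f₀) (F w)))⟩
  have hfv : ((f v : ℕ) : ℤ) = a v % (m + 1) := Int.toNat_of_nonneg (Int.emod_nonneg _ hm0.ne')
  have := Int.mul_ediv_add_emod (a v) (m + 1)
  rw [hfv]
  refine Int.ModEq.symm ((Int.modEq_iff_dvd).2 ⟨a v / (m + 1), ?_⟩)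
  rw [hkm]
  linear_combination (-(q : ℤ)) * this

/-! ### Choosing the window and combining the cases -/

/-- Some `q` consecutive colours are used at most once. -/
theorem exists_window_card_le_one [Fintype V] {k q : ℕ} (hk : 0 < k)
    (hn : Fintype.card V * q < 2 * k) (F : V → ℤ) :
    ∃ c : ℤ, ∀ u v, (F u - c) % k < q → (F v - c) % k < q → u = v := by
  classical
  by_contra! hcon
  have h2 : ∀ c ∈ Finset.range k,
      2 ≤ (Finset.univ.filter fun v => (F v - (c : ℕ)) % k < q).card := by
    intro c _
    obtain ⟨u, v, hu, hv, hne⟩ := hcon c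
    exact Finset.one_lt_card.2 ⟨u, by simpa using hu, v, by simpa using hv, hne⟩
  -- Double counting: if each of the k windows contained two vertices there would be 2k incidences,
  -- but each vertex lies in at most q windows.
  have h3 := (Finset.sum_le_sum h2).trans_eq
    (Finset.sum_card_bipartiteAbove_eq_sum_card_bipartiteBelow
      (fun (c : ℕ) v => (F v - (c : ℕ)) % k < q) (s := Finset.range k) (t := Finset.univ))
  rw [Finset.sum_const, Finset.card_range, smul_eq_mul] at h3
  have h4 : ∀ v ∈ (Finset.univ : Finset V),
      (Finset.bipartiteBelow (fun (c : ℕ) v => (F v - (c : ℕ)) % k < q)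
        (Finset.range k) v).card ≤ q := by
    intro v _
    calc _ ≤ (Finset.range q).card := by
          refine Finset.card_le_card_of_injOn (fun c => ((F v - (c : ℕ)) % k).toNat) ?_ ?_
          · intro c hc
            have hc' := (Finset.mem_bipartiteBelow _).1 hc
            have := Int.emod_nonneg (F v - (c : ℕ)) (b := k) (by omega)
            simp only [Finset.coe_range, Set.mem_Iio]
            omega
          · intro c hc c' hc' e
            have hc := Finset.mem_range.1 ((Finset.mem_bipartiteBelow _).1 hc).1
            have hc' := Finset.mem_range.1 ((Finset.mem_bipartiteBelow _).1 hc').1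
            have h1 := Int.emod_nonneg (F v - (c : ℕ)) (b := k) (by omega)
            have h2 := Int.emod_nonneg (F v - (c' : ℕ)) (b := k) (by omega)
            have e' : (F v - (c : ℕ)) % k = (F v - (c' : ℕ)) % k := by
              dsimp only at e
              omega
            obtain ⟨n, hn⟩ := Int.ModEq.dvd e'
            have hn1 : n < 1 := by
              by_contra hcon'
              nlinarith
            have hn2 : -1 < n := by
              by_contra hcon'
              nlinarith
            obtain rfl : n = 0 := by omega
            omega
      _ = q := Finset.card_range q
  have h5 := Finset.sum_le_sum h4
  rw [Finset.sum_const, Finset.card_univ, smul_eq_mul] at h5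
  have := h3.trans h5
  omega

theorem reachesMultiples_of_card [Fintype V] {G : SimpleGraph V} {k q m : ℕ} (hq : 1 ≤ q)
    (hm1 : 1 ≤ m) (hm : m * q < k) (hmk : k ≤ (m + 1) * q)
    (hn : (Fintype.card V + 1) * q < 2 * k) (hmix : G.IsMixing (m + 1))
    (f₀ : G →g completeGraph (Fin m)) {F : V → ℤ} (hF : G.IsCircularColouring k q F) :
    G.ReachesMultiples k q m F := by
  classical
  have hk : 0 < k := by omega
  have hkz : (k : ℤ) ≠ 0 := by omega
  have hk0 : (0 : ℤ) < k := by omega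
  have hqk : (q : ℤ) ≤ k := by
    have : q ≤ m * q := Nat.le_mul_of_pos_left q hm1
    omega
  obtain ⟨c, hc⟩ := exists_window_card_le_one hk (q := q) (by nlinarith) F
  have hE₀ : G.IsCircularColouring k q fun v => 1 * F v + -c := hF.affine (Or.inl rfl) (-c)
  obtain ⟨E, hE⟩ : ∃ E : V → ℤ, E = fun v => (F v - c) % k := ⟨_, rfl⟩
  have hmod : ∀ v, (1 * F v + -c) % k = E v % k := fun v => by
    rw [hE, Int.emod_emod_of_dvd _ (dvd_refl _), one_mul, sub_eq_add_neg]
  have hEcol : G.IsCircularColouring k q E := hE₀.congr hmod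
  suffices hgood : G.ReachesMultiples k q m E by
    have h := (ReachesMultiples.of_reachable (.of_emod_eq hk hq hE₀ hmod) hgood).affine
      (Or.inl rfl) c
    convert h using 2
    ring
  have h0 : ∀ v, 0 ≤ E v := fun v => by rw [hE]; exact Int.emod_nonneg _ hkz
  have hlt : ∀ v, E v < k := fun v => by rw [hE]; exact Int.emod_lt_of_pos _ hk0
  by_cases hw : ∃ w, E w < q
  swap
  · push Not at hw
    exact reachesMultiples_of_window_empty hq hm hmk hEcol hw hlt
  obtain ⟨w, hw⟩ := hw
  have hbig : ∀ v, v ≠ w → q ≤ E v := fun v hv => by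
    by_contra hcon
    rw [hE] at hw hcon
    exact hv (hc v w (not_le.1 hcon) hw)
  rcases hmk.lt_or_eq with hmk' | hmk'
  swap
  · exact reachesMultiples_of_dvd hq hmk' hEcol w (h0 w) hbig hlt hmix f₀
  by_cases hx : ∃ x, G.IncreasingWalk E w m x
  swap
  · push Not at hx
    exact reachesMultiples_of_not_increasingWalk hq hm1 hm hmk hEcol w (h0 w) hw hbig hlt hx
  obtain ⟨x, hx⟩ := hx
  -- The reflection x ↦ q - 1 - x maps the window [0,q) to itself, so w is again the only vertex in
  -- it.
  obtain ⟨E', hE'⟩ : ∃ E' : V → ℤ, E' = fun v => (-1 * E v + (q - 1)) % k := ⟨_, rfl⟩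
  have hE₁ := hEcol.affine (Or.inr rfl) (q - 1)
  have hmod' : ∀ v, (-1 * E v + (q - 1)) % k = E' v % k := fun v => by
    rw [hE', Int.emod_emod_of_dvd _ (dvd_refl _)]
  have hE'col : G.IsCircularColouring k q E' := hE₁.congr hmod'
  have h0' : ∀ v, 0 ≤ E' v := fun v => by rw [hE']; exact Int.emod_nonneg _ hkz
  have hlt' : ∀ v, E' v < k := fun v => by rw [hE']; exact Int.emod_lt_of_pos _ hk0
  have hw' : E' w = q - 1 - E w := by
    rw [hE']
    have := h0 w
    dsimp only
    rw [Int.emod_eq_of_lt] <;> linarith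
  have hbig' : ∀ v, v ≠ w → E' v = k + q - 1 - E v := fun v hv => by
    rw [hE']
    have := hbig v hv
    have := hlt v
    dsimp only
    rw [← Int.add_emod_right, Int.emod_eq_of_lt] <;> linarith
  by_cases hy : ∃ y, G.IncreasingWalk E' w m y
  · obtain ⟨y, hy⟩ := hy
    have := two_mul_add_one_le_card_of_increasingWalk hq hmk'
      (fun u v huv hle => (hEcol.le_sub hq h0 hlt huv hle).1)
      (fun u v huv hle => (hE'col.le_sub hq h0' hlt' huv hle).1)
      hw (h0 w) hlt hlt' hw' hbig' hx hy
    nlinarith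
  · push Not at hy
    have hE'good : G.ReachesMultiples k q m E' :=
      reachesMultiples_of_not_increasingWalk hq hm1 hm hmk hE'col w (h0' w)
        (by rw [hw']; have := h0 w; linarith)
        (fun v hv => by rw [hbig' v hv]; have := hlt v; linarith) hlt' hy
    have h := (ReachesMultiples.of_reachable (.of_emod_eq hk hq hE₁ hmod') hE'good).affine
      (Or.inr rfl) (q - 1)
    convert h using 2
    ring

/-- Every colouring is joined to the fixed one q·f₀: reach multiples of q, change the m-colouring to
f₀ by m-mixing, then shift the constant to 0. -/
theorem isCircularMixing_of_isMixing [Fintype V] {G : SimpleGraph V} {k q m : ℕ} (hq : 1 ≤ q)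
    (hm1 : 1 ≤ m) (hm : m * q < k) (hmk : k ≤ (m + 1) * q)
    (hn : (Fintype.card V + 1) * q < 2 * k) (hmix : G.IsMixing m) (hmix' : G.IsMixing (m + 1)) :
    G.IsCircularMixing k q := by
  have hk : 0 < k := by omega
  obtain ⟨f₀⟩ := hmix.nonempty
  have key : ∀ f : G →g circularClique k q,
      G.CircularReachable k q (fun v => (f v : ℤ)) fun v => q * (f₀ v : ℤ) + 0 := by
    intro f
    obtain ⟨h, c, hh⟩ := reachesMultiples_of_card hq hm1 hm hmk hn hmix' f₀
      (isCircularColouring_val f)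
    exact (hh.trans (hmix.circularReachable hk hq hm.le h f₀ c)).trans
      (circularReachable_multiples_add hq hm f₀ c 0)
  have : Nonempty (G →g circularClique k q) :=
    ⟨circularHom hk hq _ (isCircularColouring_multiples hm.le f₀ 0)⟩
  refine (connected_iff _).2 ⟨fun f g => ?_, this⟩
  obtain ⟨_, _, _, _, h⟩ := (key f).trans (key g).symm
  rwa [circularHom_val, circularHom_val] at h

/-! ### The thresholds -/

/-- Two colourings use at most 2|V| colours, leaving |V| others for an injective colouring to which
both can be changed, vertex by vertex in any order. -/
theorem isMixing_of_three_mul_card_le [Fintype V] (G : SimpleGraph V) {k : ℕ}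
    (hk : 3 * Fintype.card V ≤ k) : G.IsMixing k := by
  classical
  have hex : ∀ f g : V → Fin k, ∃ h : V → Fin k, Function.Injective h ∧
      ∀ u v, h u ≠ f v ∧ h u ≠ g v := by
    intro f g
    let S : Finset (Fin k) := (Finset.univ.image f ∪ Finset.univ.image g)ᶜ
    have hS : Fintype.card V ≤ Fintype.card S := by
      have h1 : (Finset.univ.image f).card ≤ Fintype.card V := Finset.card_image_le
      have h2 : (Finset.univ.image g).card ≤ Fintype.card V := Finset.card_image_le
      have h3 := Finset.card_union_le (Finset.univ.image f) (Finset.univ.image g)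
      rw [Fintype.card_coe, Finset.card_compl, Fintype.card_fin]
      omega
    obtain ⟨e⟩ := Function.Embedding.nonempty_of_card_le hS
    refine ⟨fun v => e v, fun u v huv => e.injective (Subtype.ext huv), fun u v => ?_⟩
    have := (e u).2
    simp only [S, Finset.mem_compl, Finset.mem_union, Finset.mem_image, Finset.mem_univ,
      true_and, not_or, not_exists] at this
    exact ⟨fun h => this.1 v h.symm, fun h => this.2 v h.symm⟩
  have hnon : Nonempty (G →g completeGraph (Fin k)) := by
    have : Fintype.card V ≤ Fintype.card (Fin k) := by rw [Fintype.card_fin]; omega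
    obtain ⟨e⟩ := Function.Embedding.nonempty_of_card_le this
    exact ⟨⟨e, fun {u v} huv h => huv.ne (e.injective h)⟩⟩
  refine (connected_iff _).2 ⟨fun f g => ?_, hnon⟩
  obtain ⟨h, hinj, hh⟩ := hex f g
  let h' : G →g completeGraph (Fin k) := ⟨h, fun {u v} huv e => huv.ne (hinj e)⟩
  refine (colourGraph_reachable_of_priority f h' (fun _ => 0) fun u v _ _ => (hh u v).1).trans
    (colourGraph_reachable_of_priority g h' (fun _ => 0) fun u v _ _ => (hh u v).2).symm

theorem mixingBounds_nonempty [Fintype V] (G : SimpleGraph V) : G.mixingBounds.Nonempty := by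
  refine ⟨3 * Fintype.card V, ?_, fun k hk => G.isMixing_of_three_mul_card_le hk⟩
  exact (G.colorable_of_fintype.mono (by omega)).chromaticNumber_le

theorem circularChromaticNumber_le_of_hom {G : SimpleGraph V} {N : ℕ} (hN : 2 ≤ N)
    (f : G →g completeGraph (Fin N)) : G.circularChromaticNumber ≤ N := by
  refine csInf_le ⟨0, ?_⟩ ⟨N, 1, le_rfl, by omega,
    ⟨circularHom (by omega) le_rfl _ (isCircularColouring_multiples (by omega) f 0)⟩, by simp⟩
  rintro _ ⟨k, q, -, -, -, rfl⟩
  positivity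

theorem mem_circularMixingBounds [Fintype V] (G : SimpleGraph V)
    (hG : (∃ u v : V, G.Adj u v) ∨ 3 ≤ Fintype.card V) {r : ℚ}
    (hn : ((Fintype.card V : ℝ) + 1) / 2 < r) (hr : (G.mixingThreshold : ℝ) < r) :
    r ∈ G.circularMixingBounds := by
  have hmem : G.mixingThreshold ∈ G.mixingBounds := Nat.sInf_mem G.mixingBounds_nonempty
  obtain ⟨hχ, hmix⟩ := hmem
  have hcol : G.Colorable G.mixingThreshold := chromaticNumber_le_iff_colorable.1 hχ
  have hV : Nonempty V := by
    rcases hG with ⟨u, -⟩ | h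
    · exact ⟨u⟩
    · exact Fintype.card_pos_iff.1 (by omega)
  have hpos : 1 ≤ G.mixingThreshold := by
    obtain ⟨f⟩ := hcol
    have := (f hV.some).2
    omega
  refine ⟨?_, fun k q hq hk hrk => ?_⟩
  · by_cases h2 : 2 ≤ G.mixingThreshold
    · obtain ⟨f⟩ := hcol
      exact (circularChromaticNumber_le_of_hom h2 f).trans hr.le
    -- Ratios k/q are at least 2, so the bound through χ fails for χ = 1. Then G has no edge, and
    -- three vertices give r > (3+1)/2 = 2.
    · have h1 : G.mixingThreshold = 1 := by omega
      obtain ⟨f⟩ := hcol.mono (by omega : G.mixingThreshold ≤ 2)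
      refine (circularChromaticNumber_le_of_hom le_rfl f).trans ?_
      rcases hG with ⟨u, v, huv⟩ | h
      · obtain ⟨g⟩ := hcol
        have := (g u).2
        have := (g v).2
        exact absurd (Fin.ext (by omega)) (g.map_adj huv)
      · have : (3 : ℝ) ≤ Fintype.card V := by exact_mod_cast h
        push_cast
        linarith
  · have hq0 : (0 : ℝ) < q := by exact_mod_cast hq
    have hrk' : (r : ℝ) ≤ (k : ℝ) / q := by
      have := (Rat.cast_le (K := ℝ)).2 hrk
      push_cast at this
      exact this
    have h1 : (Fintype.card V + 1) * q < 2 * k := by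
      have : ((Fintype.card V : ℝ) + 1) / 2 < (k : ℝ) / q := hn.trans_le hrk'
      rw [div_lt_div_iff₀ two_pos hq0] at this
      have h : (Fintype.card V + 1) * q < k * 2 := by exact_mod_cast this
      omega
    have h2 : G.mixingThreshold * q < k := by
      have : (G.mixingThreshold : ℝ) < (k : ℝ) / q := hr.trans_le hrk'
      rw [lt_div_iff₀ hq0] at this
      exact_mod_cast this
    -- This m is ⌈k/q⌉ - 1, which makes mq < k strict even when q divides k.
    obtain ⟨m, hm⟩ : ∃ m, m = (k - 1) / q := ⟨_, rfl⟩
    have hmq : m * q < k := by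
      have := Nat.div_mul_le_self (k - 1) q
      rw [← hm] at this
      omega
    have hMm : G.mixingThreshold ≤ m := by
      rw [hm, Nat.le_div_iff_mul_le (by omega)]
      omega
    have hmk : k ≤ (m + 1) * q := by
      have := Nat.lt_mul_of_div_lt (hm ▸ Nat.lt_succ_self m : (k - 1) / q < m + 1) (by omega)
      omega
    exact isCircularMixing_of_isMixing hq (hpos.trans hMm) hmq hmk h1 (hmix m hMm)
      (hmix (m + 1) (by omega))

end SimpleGraph

theorem mainTheorem5 {V : Type*} [Fintype V] (G : SimpleGraph V)
    (hG : (∃ u v : V, G.Adj u v) ∨ 3 ≤ Fintype.card V) :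
    G.mixingBounds.Nonempty ∧ G.circularMixingBounds.Nonempty ∧
      G.circularMixingThreshold ≤
        max (((Fintype.card V : ℝ) + 1) / 2) (G.mixingThreshold : ℝ) := by
  have key : ∀ r : ℚ, max (((Fintype.card V : ℝ) + 1) / 2) (G.mixingThreshold : ℝ) < r →
      r ∈ G.circularMixingBounds := fun r hr =>
    G.mem_circularMixingBounds hG ((le_max_left _ _).trans_lt hr) ((le_max_right _ _).trans_lt hr)
  refine ⟨G.mixingBounds_nonempty, ?_, le_of_forall_gt_imp_ge_of_dense fun x hx => ?_⟩
  · obtain ⟨r, hr⟩ := exists_rat_gt (max (((Fintype.card V : ℝ) + 1) / 2) (G.mixingThreshold : ℝ))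
    exact ⟨r, key r hr⟩
  · obtain ⟨r, hr, hrx⟩ := exists_rat_btwn hx
    refine le_trans (csInf_le ⟨G.circularChromaticNumber, ?_⟩ ⟨r, key r hr, rfl⟩) hrx.le
    rintro _ ⟨s, hs, rfl⟩
    exact hs.1
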